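/- Let $R$ be a Dedekind domain whose field of fractions $F$ is a number field (for example $R=O_F$), let $F^c$ be an algebraic closure of $F$ and put $\Omega_F=\mathrm{Gal}(F^c/F)$. Let $G=\mathrm{Spec}(\mathfrak B)$ be a finite, flat, commutative group scheme over $R$, let $G^*=\mathrm{Spec}(\mathfrak A)$ be its Cartier dual (so $\mathfrak A=\mathrm{Hom}_R(\mathfrak B,R)$ with the convolution product), and write $A_E=\mathfrak A\otimes_R E$ for every $R$-algebra $E$ and $A=A_F$. Put $\Gamma=G(F^c)=\mathrm{Hom}_{R\text{-alg}}(\mathfrak B,F^c)$, with its natural $\Omega_F$-action; it is a subgroup of $A_{F^c}^\times$ through $A_{F^c}=\mathrm{Hom}_R(\mathfrak B,F^c)$. Let $K_0(\mathfrak A,F^c)$ be the relative algebraic $K$-group: it is generated by the isomorphism classes $[L_1,L_2;\lambda]$ of triples consisting of finitely generated projective $\mathfrak A$-modules $L_1,L_2$ and an isomorphism $\lambda:L_1\otimes_R F^c\to L_2\otimes_R F^c$ of $A_{F^c}$-modules, with the relations $[L_1',L_2';\lambda']=[L_1,L_2;\lambda]+[L_1'',L_2'';\lambda'']$ for short exact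 sequences and $[M_1,M_2;\eta\circ\eta']=[M_1,M_3;\eta']+[M_3,M_2;\eta]$. In the idelic description, $K_0(\mathfrak A,F^c)$ is the cokernel of $$\Delta':A^\times\to \frac{J_f(A)}{U_f(\mathfrak A)}\times A_{F^c}^\times,\qquad a\mapsto (a)\times a^{-1},$$ where $v$ runs over the nonzero prime ideals of $R$, $R_v$ and $F_v$ are the $v$-adic completions of $R$ and $F$, $\mathfrak A_v=\mathfrak A\otimes_R R_v$, $A_v=\mathfrak A\otimes_R F_v$, $J_f(A)$ is the restricted product of the groups $A_v^\times$ with respect to the groups $\mathfrak M_v^\times$ for the maximal $R$-order $\mathfrak M$ of $A$ (the integral closure of $R$ in $A$), with $\mathfrak M_v=\mathfrak M\otimes_R R_v$, and $U_f(\mathfrak A)=\prod_v\mathfrak A_v^\times$; here $[\mathfrak A,\mathfrak A;a]$ corresponds to the class of $(1)\times a$ for $a\in A_{F^c}^\times$. Let $\Delta''$ be the composite of $\Delta'$ with the projection to $\frac{J_f(A)}{U_f(\mathfrak A)}\times A_{F^c}^\times/\Gamma$. The group $\overline K_0(\mathfrak A,F^c)$ is the quotient of $K_0(\mathfrak A,F^c)$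 that corresponds to the cokernel of $\Delta''$, that is, the quotient of $K_0(\mathfrak A,F^c)$ by the subgroup of all classes $[\mathfrak A,\mathfrak A;\gamma]$ with $\gamma\in\Gamma$. Then the natural projection $K_0(\mathfrak A,F^c)\to\overline K_0(\mathfrak A,F^c)$ is bijective if and only if every point of $\Gamma$ is fixed by $\Omega_F$. This holds both for the relative $K$-group, that is, for the projection of $K_0(\mathfrak A,F^c)$ to its quotient by $\{[\mathfrak A,\mathfrak A;\gamma]:\gamma\in\Gamma\}$, and for its idelic description, that is, for the natural projection $\mathrm{Cok}(\Delta')\to\mathrm{Cok}(\Delta'')$. -/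

import Mathlib

open scoped TensorProduct

noncomputable section

/-! ### Twisted forms and the relative algebraic `K`-group -/

namespace RelK

/-- An object of the fibre product category `P_𝔄 ×_{P_S} P_𝔄`, where `𝔄 → S` is a homomorphism of
commutative rings and both functors are the scalar extension `S ⊗_𝔄 -`: a triple `(L₁, L₂; iso)` of
two finitely generated projective `𝔄`-modules and an isomorphism of the scalar extensions. -/
structure TwistedForm.{v, s} (𝔄 : Type v) (S : Type s) [CommRing 𝔄] [CommRing S]
    [Algebra 𝔄 S] where
  L₁ : Type v
  L₂ : Type v
  [acg₁ : AddCommGroup L₁]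
  [acg₂ : AddCommGroup L₂]
  [mod₁ : Module 𝔄 L₁]
  [mod₂ : Module 𝔄 L₂]
  [fin₁ : Module.Finite 𝔄 L₁]
  [fin₂ : Module.Finite 𝔄 L₂]
  [proj₁ : Module.Projective 𝔄 L₁]
  [proj₂ : Module.Projective 𝔄 L₂]
  iso : (S ⊗[𝔄] L₁) ≃ₗ[S] (S ⊗[𝔄] L₂)

attribute [instance] TwistedForm.acg₁ TwistedForm.acg₂ TwistedForm.mod₁ TwistedForm.mod₂
  TwistedForm.fin₁ TwistedForm.fin₂ TwistedForm.proj₁ TwistedForm.proj₂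

universe v s

variable (𝔄 : Type v) (S : Type s) [CommRing 𝔄] [CommRing S] [Algebra 𝔄 S]

/-- A morphism of twisted forms: a pair of `𝔄`-linear maps compatible with the isomorphisms. -/
structure TwistedForm.Hom {𝔄 : Type v} {S : Type s} [CommRing 𝔄] [CommRing S] [Algebra 𝔄 S]
    (X Y : TwistedForm 𝔄 S) where
  f₁ : X.L₁ →ₗ[𝔄] Y.L₁
  f₂ : X.L₂ →ₗ[𝔄] Y.L₂
  comm : Y.iso.toLinearMap ∘ₗ f₁.baseChange S = f₂.baseChange S ∘ₗ X.iso.toLinearMap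

/-- The defining relations of the relative `K`-group, as elements of the free abelian group on all
twisted forms: isomorphic forms are identified, and the relations (i) for short exact sequences
and (ii) for composites are imposed. -/
inductive IsRelation : FreeAbelianGroup (TwistedForm 𝔄 S) → Prop
  | iso (X Y : TwistedForm 𝔄 S) (α : X.Hom Y)
      (h₁ : Function.Bijective α.f₁) (h₂ : Function.Bijective α.f₂) :
      IsRelation (FreeAbelianGroup.of X - FreeAbelianGroup.of Y)
  | exact (X Y Z : TwistedForm 𝔄 S) (α : X.Hom Y) (β : Y.Hom Z)
      (inj₁ : Function.Injective α.f₁) (ex₁ : Function.Exact α.f₁ β.f₁)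
      (surj₁ : Function.Surjective β.f₁)
      (inj₂ : Function.Injective α.f₂) (ex₂ : Function.Exact α.f₂ β.f₂)
      (surj₂ : Function.Surjective β.f₂) :
      IsRelation (FreeAbelianGroup.of Y - (FreeAbelianGroup.of X + FreeAbelianGroup.of Z))
  | comp (M₁ M₂ M₃ : Type v) [AddCommGroup M₁] [AddCommGroup M₂] [AddCommGroup M₃]
      [Module 𝔄 M₁] [Module 𝔄 M₂] [Module 𝔄 M₃]
      [Module.Finite 𝔄 M₁] [Module.Finite 𝔄 M₂] [Module.Finite 𝔄 M₃]
      [Module.Projective 𝔄 M₁] [Module.Projective 𝔄 M₂] [Module.Projective 𝔄 M₃]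
      (η' : (S ⊗[𝔄] M₁) ≃ₗ[S] (S ⊗[𝔄] M₃)) (η : (S ⊗[𝔄] M₃) ≃ₗ[S] (S ⊗[𝔄] M₂)) :
      IsRelation (FreeAbelianGroup.of ⟨M₁, M₂, η'.trans η⟩ -
        (FreeAbelianGroup.of ⟨M₁, M₃, η'⟩ + FreeAbelianGroup.of ⟨M₃, M₂, η⟩))

/-- The relative algebraic `K`-group `K₀` of a homomorphism `𝔄 → S` of commutative rings. -/
abbrev K0 : Type (max (v + 1) s) :=
  FreeAbelianGroup (TwistedForm 𝔄 S) ⧸ AddSubgroup.closure {x | IsRelation 𝔄 S x}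

variable {𝔄 S} in
/-- The class `[L₁, L₂; iso]` of a twisted form. -/
def K0.mk (X : TwistedForm 𝔄 S) : K0 𝔄 S := QuotientAddGroup.mk (FreeAbelianGroup.of X)

variable {S} in
/-- The twisted form `(𝔄, 𝔄; s)` given by multiplication by a unit `s` of `S`. -/
def unitForm (s : Sˣ) : TwistedForm 𝔄 S := ⟨𝔄, 𝔄, LinearEquiv.smulOfUnit s⟩

variable {S} in
theorem K0.mk_unitForm_mul (s t : Sˣ) :
    K0.mk (unitForm 𝔄 (s * t)) = K0.mk (unitForm 𝔄 s) + K0.mk (unitForm 𝔄 t) := by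
  have e : unitForm 𝔄 (s * t) =
      ⟨𝔄, 𝔄, (LinearEquiv.smulOfUnit s).trans (LinearEquiv.smulOfUnit t)⟩ := by
    unfold unitForm
    congr 1
    ext
    simp [LinearEquiv.smulOfUnit, Units.smul_def, mul_smul]
  rw [e, ← sub_eq_zero]
  exact (QuotientAddGroup.eq_zero_iff _).2 (AddSubgroup.subset_closure (IsRelation.comp _ _ _ _ _))

/-- The restriction to `Sˣ` of the connecting homomorphism `K₁(S) → K₀(𝔄, S)`, that is
`s ↦ [𝔄, 𝔄; s]`. -/
def boundary : Additive Sˣ →+ K0 𝔄 S :=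
  AddMonoidHom.mk' (fun s => K0.mk (unitForm 𝔄 s.toMul)) fun s t =>
    K0.mk_unitForm_mul 𝔄 s.toMul t.toMul

end RelK

/-! ### The Cartier dual and the points of a finite flat commutative group scheme

The finite flat commutative group scheme `G = Spec B` is given by its commutative and cocommutative
Hopf algebra `B`, which is a finite flat `R`-module. -/

namespace GroupScheme

universe u w

variable (R : Type u) [CommRing R] (B : Type w) [CommRing B] [HopfAlgebra R B]
  [Coalgebra.IsCocomm R B]

/-- The coordinate ring `𝔄` of the Cartier dual of `Spec B`: the `R`-linear dual of `B`, with the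
convolution product. -/
def Dual : Type (max u w) := WithConv (B →ₗ[R] R)

instance : CommRing (Dual R B) := inferInstanceAs (CommRing (WithConv (B →ₗ[R] R)))

instance : Algebra R (Dual R B) := inferInstanceAs (Algebra R (WithConv (B →ₗ[R] R)))

/-- The identification of `𝔄` with the `R`-linear dual of `B`, as an `R`-module. -/
def dualEquiv : Dual R B ≃ₗ[R] (B →ₗ[R] R) := WithConv.linearEquiv R (B →ₗ[R] R)

theorem projective_of_finite_flat [IsNoetherianRing R] [Module.Finite R B] [Module.Flat R B] :
    Module.Projective R B :=
  have := Module.finitePresentation_of_finite R B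
  Module.Flat.projective_of_finitePresentation

theorem dual_finite [IsNoetherianRing R] [Module.Finite R B] [Module.Flat R B] :
    Module.Finite R (Dual R B) :=
  have := projective_of_finite_flat R B
  Module.Finite.equiv (dualEquiv R B).symm

/-- The scalar extension `𝔄_E = 𝔄 ⊗_R E`. -/
abbrev DualExt (E : Type*) [CommRing E] [Algebra R E] := Dual R B ⊗[R] E

/-- The map `𝔄_E → 𝔄_{E'}` induced by an `R`-algebra homomorphism `E → E'`. -/
def extMap {E E' : Type*} [CommRing E] [Algebra R E] [CommRing E'] [Algebra R E']
    (f : E →ₐ[R] E') : DualExt R B E →ₐ[R] DualExt R B E' :=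
  Algebra.TensorProduct.map (AlgHom.id R (Dual R B)) f

section Points

variable (E : Type*) [CommRing E] [Algebra R E]

instance : IsScalarTower R E (WithConv (B →ₗ[R] E)) :=
  ⟨fun r e f => by ext b; simp⟩

/-- Composition with `R → E`, as a homomorphism of convolution algebras. -/
def dualToConv : Dual R B →ₐ[R] WithConv (B →ₗ[R] E) :=
  AlgHom.ofLinearMap
    { toFun := fun f => WithConv.toConv (Algebra.linearMap R E ∘ₗ dualEquiv R B f)
      map_add' := fun f g => by ext; simp
      map_smul' := fun r f => by
        apply WithConv.ext
        ext b
        rw [map_smul]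
        change algebraMap R E (r • dualEquiv R B f b) = r • algebraMap R E (dualEquiv R B f b)
        rw [smul_eq_mul, map_mul, Algebra.smul_def] }
    (WithConv.ext (by ext b; rfl))
    (fun f g => WithConv.ext (LinearMap.algHom_comp_convMul_distrib (Algebra.ofId R E)
      (WithConv.toConv (dualEquiv R B f)) (WithConv.toConv (dualEquiv R B g))))

/-- The canonical homomorphism `𝔄 ⊗_R E → Hom_R(B, E)`, `f ⊗ c ↦ (b ↦ f(b)c)`. -/
def extToConv : DualExt R B E →ₐ[R] WithConv (B →ₗ[R] E) :=
  Algebra.TensorProduct.lift (dualToConv R B E)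
    (IsScalarTower.toAlgHom R E (WithConv (B →ₗ[R] E))) fun _ _ => Commute.all _ _

theorem extToConv_tmul (f : Dual R B) (c : E) (b : B) :
    (extToConv R B E (f ⊗ₜ c)).ofConv b = dualEquiv R B f b • c := by
  have h : extToConv R B E (f ⊗ₜ c) = c • dualToConv R B E f := by
    rw [extToConv, Algebra.TensorProduct.lift_tmul, mul_comm, Algebra.smul_def]
    rfl
  rw [h]
  change c • algebraMap R E (dualEquiv R B f b) = dualEquiv R B f b • c
  rw [smul_eq_mul, mul_comm, Algebra.smul_def]

theorem extToConv_bijective [IsNoetherianRing R] [Module.Finite R B] [Module.Flat R B] :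
    Function.Bijective (extToConv R B E) := by
  have := projective_of_finite_flat R B
  have h : ∀ x : DualExt R B E, (extToConv R B E x).ofConv =
      dualTensorHom R B E ((dualEquiv R B).rTensor E x) := by
    intro x
    induction x using TensorProduct.induction_on with
    | zero => simp
    | add x y hx hy => simp [hx, hy]
    | tmul f c =>
      ext b
      rw [extToConv_tmul]
      simp [dualTensorHom_apply]
  have h' := (dualTensorHom_bijective (R := R) (M := B) (N := E)).comp
    ((dualEquiv R B).rTensor E).bijective
  have h'' : Function.Bijective fun x => (extToConv R B E x).ofConv := by
    convert h' using 1
    ext1 x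
    exact h x
  exact (WithConv.ofConv_bijective.of_comp_iff' _).1 h''

/-- The group `G(E)` of `E`-valued points of `G = Spec B`. -/
abbrev Points := WithConv (B →ₐ[R] E)

/-- The group structure of `G(E)`, given by convolution; inversion is composition with the
antipode. -/
instance pointsCommGroup : CommGroup (Points R B E) where
  inv γ := WithConv.toConv (γ.ofConv.comp (HopfAlgebra.antipodeAlgHom R B))
  inv_mul_cancel γ := by
    have h := AlgHom.comp_convMul_distrib γ.ofConv
      (WithConv.toConv (AlgHom.id R B))⁻¹ (WithConv.toConv (AlgHom.id R B))
    rw [inv_mul_cancel] at h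
    apply WithConv.ext
    refine Eq.trans h.symm ?_
    ext b
    simp
  mul_comm := mul_comm

/-- A point of `G(E)`, regarded as an element of the convolution algebra `Hom_R(B, E)`. -/
def pointsToConv : Points R B E →* WithConv (B →ₗ[R] E) where
  toFun γ := WithConv.toConv γ.ofConv.toLinearMap
  map_one' := rfl
  map_mul' := fun γ δ => AlgHom.toLinearMap_convMul γ δ

variable [IsNoetherianRing R] [Module.Finite R B] [Module.Flat R B]

/-- The inclusion of `G(E)` in the unit group of `𝔄_E`: the point `γ : B → E` corresponds to the
element `γ` of `Hom_R(B, E) = 𝔄 ⊗_R E`. -/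
def pointsToUnits : Points R B E →* (DualExt R B E)ˣ :=
  ((RingEquiv.ofBijective (extToConv R B E) (extToConv_bijective R B E)).symm.toMonoidHom.comp
    (pointsToConv R B E)).toHomUnits

theorem extToConv_pointsToUnits (γ : Points R B E) (b : B) :
    (extToConv R B E (pointsToUnits R B E γ)).ofConv b = γ.ofConv b := by
  have h : extToConv R B E (pointsToUnits R B E γ) = pointsToConv R B E γ :=
    (RingEquiv.ofBijective (extToConv R B E) (extToConv_bijective R B E)).apply_symm_apply
      (pointsToConv R B E γ)
  rw [h]
  rfl

end Points

/-! ### The group `K₀(𝔄, E)` and its quotient by the classes of the points of `G` -/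

section RelativeK

variable (E : Type*) [CommRing E] [Algebra R E]

/-- The relative `K`-group `K₀(𝔄, E)`, for the scalar extension `𝔄 → 𝔄 ⊗_R E`. -/
abbrev K0 := RelK.K0 (Dual R B) (DualExt R B E)

variable [IsNoetherianRing R] [Module.Finite R B] [Module.Flat R B]

/-- The image of `Γ = G(E)` in `K₀(𝔄, E)`, that is the subgroup of all `[𝔄, 𝔄; γ]`. In the idelic
description of `K₀(𝔄, E)` the class `[𝔄, 𝔄; a]` of `a ∈ 𝔄_Eˣ` is represented by `(1) × a`. -/
def pointClasses : AddSubgroup (K0 R B E) :=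
  ((RelK.boundary (Dual R B) (DualExt R B E)).comp
    (MonoidHom.toAdditive (pointsToUnits R B E))).range

/-- The quotient of `K₀(𝔄, E)` by the image of `Γ`. -/
abbrev K0bar := K0 R B E ⧸ pointClasses R B E

/-- The natural projection from `K₀(𝔄, E)` to its quotient by the image of `Γ`. -/
def K0proj : K0 R B E →+ K0bar R B E := QuotientAddGroup.mk' _

end RelativeK

/-! ### The idelic description -/

section Idelic

open IsDedekindDomain

variable [IsDedekindDomain R] (F : Type*) [Field F] [Algebra R F] [IsFractionRing R F]

/-- The maximal order `𝔐` of `A`: the integral closure of `R` in the commutative algebra `A`. -/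
abbrev maxOrder : Subalgebra R (DualExt R B F) := integralClosure R (DualExt R B F)

variable (v : HeightOneSpectrum R)

/-- The `v`-adic completion `A_v = 𝔄 ⊗_R F_v` of `A`. -/
abbrev Aloc := DualExt R B (v.adicCompletion F)

/-- The natural map `A → A_v`. -/
def toAloc : DualExt R B F →ₐ[R] Aloc R B F v :=
  extMap R B (IsScalarTower.toAlgHom R F (v.adicCompletion F))

/-- `𝔄_v = 𝔄 ⊗_R R_v`, regarded as a subring of `A_v`. -/
def orderLoc : Subalgebra R (Aloc R B F v) :=
  (extMap R B (IsScalarTower.toAlgHom R (v.adicCompletionIntegers F) (v.adicCompletion F))).range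

/-- `𝔐_v = 𝔐 ⊗_R R_v`, regarded as a subring of `A_v`. -/
def maxOrderLoc : Subalgebra R (Aloc R B F v) :=
  (Algebra.TensorProduct.lift ((toAloc R B F v).comp (maxOrder R B F).val)
    ((Algebra.TensorProduct.includeRight : v.adicCompletion F →ₐ[R] Aloc R B F v).comp
      (IsScalarTower.toAlgHom R (v.adicCompletionIntegers F) (v.adicCompletion F)))
    fun _ _ => Commute.all _ _).range

/-- The group `𝔐_vˣ`, regarded as a subgroup of `A_vˣ`. -/
def maxOrderUnits : Subgroup (Aloc R B F v)ˣ := (maxOrderLoc R B F v).toSubmonoid.units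

/-- The group `𝔄_vˣ`, regarded as a subgroup of `A_vˣ`. -/
def orderUnits : Subgroup (Aloc R B F v)ˣ := (orderLoc R B F v).toSubmonoid.units

/-- The group `J_f(A)` of finite ideles of `A`: the restricted direct product of the groups `A_vˣ`
with respect to the subgroups `𝔐_vˣ`. -/
abbrev Jf := RestrictedProduct (fun v : HeightOneSpectrum R => (Aloc R B F v)ˣ)
  (fun v => maxOrderUnits R B F v) Filter.cofinite

/-- The subgroup `U_f(𝔄) = ∏_v 𝔄_vˣ` of `J_f(A)`. -/
def Uf : Subgroup (Jf R B F) where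
  carrier := {x | ∀ v, x v ∈ orderUnits R B F v}
  mul_mem' hx hy v := mul_mem (hx v) (hy v)
  one_mem' _ := one_mem _
  inv_mem' hx v := inv_mem (hx v)

/-- The quotient `J_f(A)/U_f(𝔄)`. -/
def JfModUf := Jf R B F ⧸ Uf R B F

instance : CommGroup (JfModUf R B F) := inferInstanceAs (CommGroup (Jf R B F ⧸ Uf R B F))

/-- The quotient map `J_f(A) → J_f(A)/U_f(𝔄)`. -/
def toJfModUf : Jf R B F →* JfModUf R B F := QuotientGroup.mk' (Uf R B F)

variable [Module.Finite R B] [Module.Flat R B]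

theorem orderLoc_le_maxOrderLoc : orderLoc R B F v ≤ maxOrderLoc R B F v := by
  rintro _ ⟨x, rfl⟩
  induction x using TensorProduct.induction_on with
  | zero => simp
  | add x y hx hy => simpa using add_mem hx hy
  | tmul f c =>
    have := dual_finite R B
    have hf : IsIntegral R f := Algebra.IsIntegral.isIntegral f
    have hf' : IsIntegral R (f ⊗ₜ (1 : F) : DualExt R B F) :=
      hf.map (Algebra.TensorProduct.includeLeft : Dual R B →ₐ[R] DualExt R B F)
    refine ⟨(⟨f ⊗ₜ 1, hf'⟩ : maxOrder R B F) ⊗ₜ[R] c, ?_⟩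
    simp [toAloc, extMap]

theorem eventually_mem_maxOrderLoc (x : DualExt R B F) :
    ∀ᶠ v : HeightOneSpectrum R in Filter.cofinite, toAloc R B F v x ∈ maxOrderLoc R B F v := by
  induction x using TensorProduct.induction_on with
  | zero => simp
  | add x y hx hy =>
    filter_upwards [hx, hy] with v h₁ h₂
    simpa using add_mem h₁ h₂
  | tmul f c =>
    have hc : ∀ᶠ v : HeightOneSpectrum R in Filter.cofinite,
        algebraMap F (v.adicCompletion F) c ∈ v.adicCompletionIntegers F :=
      (algebraMap F (FiniteAdeleRing R F) c).2
    filter_upwards [hc] with v hv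
    apply orderLoc_le_maxOrderLoc
    refine ⟨f ⊗ₜ[R] (⟨_, hv⟩ : v.adicCompletionIntegers F), ?_⟩
    simp only [extMap, toAloc, AlgHom.toRingHom_eq_coe, RingHom.coe_coe,
      Algebra.TensorProduct.map_tmul]
    rfl

/-- The diagonal embedding `Aˣ → J_f(A)`. -/
def diag : (DualExt R B F)ˣ →* Jf R B F where
  toFun a := ⟨fun v => Units.map (toAloc R B F v : DualExt R B F →* Aloc R B F v) a, by
    filter_upwards [eventually_mem_maxOrderLoc R B F (a : DualExt R B F),
      eventually_mem_maxOrderLoc R B F ((a⁻¹ : (DualExt R B F)ˣ) : DualExt R B F)] with v h₁ h₂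
    exact ⟨h₁, h₂⟩⟩
  map_one' := by ext v; simp
  map_mul' a b := by
    ext1 v
    exact map_mul (Units.map (toAloc R B F v : DualExt R B F →* Aloc R B F v)) a b

variable (E : Type*) [CommRing E] [Algebra R E] [Algebra F E] [IsScalarTower R F E]

/-- The homomorphism `Δ'_{𝔄,E} : Aˣ → J_f(A)/U_f(𝔄) × A_Eˣ`, `a ↦ (a) × a⁻¹`. -/
def DeltaOne : (DualExt R B F)ˣ →* JfModUf R B F × (DualExt R B E)ˣ :=
  ((toJfModUf R B F).comp (diag R B F)).prod
    (Units.map (extMap R B (IsScalarTower.toAlgHom R F E) : DualExt R B F →* DualExt R B E))⁻¹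

/-- The idelic description of `K₀(𝔄, E)`: the cokernel of `Δ'_{𝔄,E}`. -/
abbrev IdelicK0 := (JfModUf R B F × (DualExt R B E)ˣ) ⧸ (DeltaOne R B F E).range

/-- `Γ = G(E)` as a subgroup of `A_Eˣ`. -/
def Gam : Subgroup (DualExt R B E)ˣ := (pointsToUnits R B E).range

/-- The quotient `A_Eˣ/Γ`. -/
def UnitsModGam := (DualExt R B E)ˣ ⧸ Gam R B E

instance : CommGroup (UnitsModGam R B E) :=
  inferInstanceAs (CommGroup ((DualExt R B E)ˣ ⧸ Gam R B E))

/-- The quotient map `A_Eˣ → A_Eˣ/Γ`. -/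
def toUnitsModGam : (DualExt R B E)ˣ →* UnitsModGam R B E := QuotientGroup.mk' (Gam R B E)

/-- The quotient map `J_f(A)/U_f(𝔄) × A_Eˣ → J_f(A)/U_f(𝔄) × A_Eˣ/Γ`. -/
def modGam : JfModUf R B F × (DualExt R B E)ˣ →* JfModUf R B F × UnitsModGam R B E :=
  (MonoidHom.id _).prodMap (toUnitsModGam R B E)

/-- The homomorphism `Δ''_{𝔄,E}`: the composite of `Δ'_{𝔄,E}` with the quotient map. -/
def DeltaTwo : (DualExt R B F)ˣ →* JfModUf R B F × UnitsModGam R B E :=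
  (modGam R B F E).comp (DeltaOne R B F E)

/-- The quotient of the idelic `K₀(𝔄, E)` by `Γ`: the cokernel of `Δ''_{𝔄,E}`. -/
abbrev IdelicK0bar := (JfModUf R B F × UnitsModGam R B E) ⧸ (DeltaTwo R B F E).range

/-- The natural projection of cokernels. -/
def idelicProj : IdelicK0 R B F E →* IdelicK0bar R B F E :=
  QuotientGroup.map _ _ (modGam R B F E) (by
    rintro _ ⟨a, rfl⟩
    exact ⟨a, rfl⟩)

/-- Compatibility of the two quotients: under every isomorphism from `K₀(𝔄, E)` to its idelic
description which takes each `[𝔄, 𝔄; a]` to the class of `(1) × a`, the image of `Γ` in `K₀(𝔄, E)`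
corresponds to the kernel of the projection of cokernels. -/
theorem mem_pointClasses_iff (h : K0 R B E ≃+ Additive (IdelicK0 R B F E))
    (hh : ∀ a : (DualExt R B E)ˣ, h (RelK.boundary (Dual R B) (DualExt R B E) (Additive.ofMul a)) =
      Additive.ofMul (QuotientGroup.mk ((1 : JfModUf R B F), a))) (x : K0 R B E) :
    x ∈ pointClasses R B E ↔ idelicProj R B F E (h x).toMul = 1 := by
  constructor
  · rintro ⟨γ, rfl⟩
    change idelicProj R B F E
      (h (RelK.boundary _ _ (Additive.ofMul (pointsToUnits R B E γ.toMul)))).toMul = 1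
    rw [hh]
    refine (QuotientGroup.eq_one_iff _).2 ?_
    have : modGam R B F E (1, pointsToUnits R B E γ.toMul) = 1 :=
      Prod.ext rfl ((QuotientGroup.eq_one_iff _).2 ⟨_, rfl⟩)
    rw [this]
    exact one_mem _
  · intro hx
    obtain ⟨⟨j, a⟩, hy⟩ := QuotientGroup.mk_surjective (h x).toMul
    rw [← hy] at hx
    obtain ⟨b, hb⟩ := (QuotientGroup.eq_one_iff (modGam R B F E (j, a))).1 hx
    have h₁ : (DeltaOne R B F E b).1 = j := congrArg Prod.fst hb
    have h₂ : toUnitsModGam R B E (DeltaOne R B F E b).2 = toUnitsModGam R B E a :=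
      congrArg Prod.snd hb
    obtain ⟨γ, hγ⟩ := QuotientGroup.eq.1 h₂
    refine ⟨Additive.ofMul γ, h.injective ?_⟩
    change h (RelK.boundary _ _ (Additive.ofMul (pointsToUnits R B E γ))) = _
    rw [hh]
    apply Additive.toMul.injective
    rw [← hy]
    refine (QuotientGroup.eq.2 ⟨b, ?_⟩)
    refine Prod.ext ?_ ?_
    · simp [h₁]
    · change _ = (pointsToUnits R B E γ)⁻¹ * a
      rw [hγ, mul_inv_rev, inv_inv, mul_comm (a⁻¹), inv_mul_cancel_right]

end Idelic
end GroupScheme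

end

/-! Both projections are surjective, so bijectivity means that every point `γ` of `Γ` has trivial
class. If `Γ` is fixed by `Ω_F`, the values of `γ` lie in `F` and are integral over `R`, hence lie
in `R`. Then `γ` comes from a unit of `𝔄`, which dies in both descriptions
(`boundary_point_eq_zero`, `mem_range_DeltaOne`).

Conversely, a trivial idelic class forces `γ` to be the image of a unit of `A`, so `γ` is
Galois-invariant (`fixed_of_mem_range_DeltaOne`). For the relative `K`-group an invariant is needed.
Two `𝔄`-algebra maps `φ, ψ` from `S` to a field `K` turn the isomorphism of a twisted form into two
isomorphisms over `K`. The determinant of one composed with the inverse of the other respects all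
relations, and on `[𝔄, 𝔄; s]` it is `ψ(s)/φ(s)` (`compareDet`, `apply_eq_of_boundary_eq_zero`). With
`φ` the map to the residue field of a prime of `A_E` and `ψ = φ ∘ σ`, a trivial class gives `σγ ≡ γ`
modulo every prime. Thus `σγ · γ⁻¹` is unipotent; it has finite order because `Γ` is finite, so it
is `1` in characteristic zero. -/

noncomputable section

/-! ### Determinants in exact sequences -/

/-- The determinant is multiplicative on endomorphisms of short exact sequences. -/
theorem LinearMap.det_eq_mul_of_exact {K U V W : Type*} [Field K]
    [AddCommGroup U] [AddCommGroup V] [AddCommGroup W] [Module K U] [Module K V] [Module K W]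
    [Module.Finite K V] (i : U →ₗ[K] V) (p : V →ₗ[K] W) (hi : Function.Injective i)
    (hex : Function.Exact i p) (hp : Function.Surjective p)
    (f : U →ₗ[K] U) (g : V →ₗ[K] V) (h : W →ₗ[K] W)
    (hf : g ∘ₗ i = i ∘ₗ f) (hh : h ∘ₗ p = p ∘ₗ g) :
    LinearMap.det g = LinearMap.det f * LinearMap.det h := by
  have hker : LinearMap.ker p = LinearMap.range i := LinearMap.exact_iff.1 hex
  have he : LinearMap.ker p ≤ (LinearMap.ker p).comap g := fun x hx => by
    have := LinearMap.congr_fun hh x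
    rw [Submodule.mem_comap, LinearMap.mem_ker]
    rw [LinearMap.mem_ker] at hx
    simpa [hx] using this.symm
  rw [LinearMap.det_eq_det_mul_det (LinearMap.ker p) g he]
  congr 1
  · let e : U ≃ₗ[K] LinearMap.ker p :=
      (LinearEquiv.ofInjective i hi).trans (LinearEquiv.ofEq _ _ hker.symm)
    rw [← LinearMap.det_conj f e]
    congr 1
    ext x
    obtain ⟨u, rfl⟩ := e.surjective x
    have := LinearMap.congr_fun hf u
    simp only [LinearMap.comp_apply, LinearEquiv.coe_coe, LinearEquiv.symm_apply_apply]
    exact this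
  · let e : (V ⧸ LinearMap.ker p) ≃ₗ[K] W := p.quotKerEquivOfSurjective hp
    rw [← LinearMap.det_conj _ e]
    congr 1
    ext w
    obtain ⟨v, rfl⟩ := hp w
    have h₁ : e.symm (p v) = (LinearMap.ker p).mkQ v := by
      rw [LinearEquiv.symm_apply_eq]
      rfl
    have := LinearMap.congr_fun hh v
    simp only [LinearMap.comp_apply, LinearEquiv.coe_coe, h₁] at this ⊢
    rw [this]
    rfl

/-! ### The determinant invariant of twisted forms -/

namespace RelK

section Specialization

variable {𝔄 S K : Type*} [CommRing 𝔄] [CommRing S] [Algebra 𝔄 S] [CommRing K] [Algebra 𝔄 K]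
  {L M N : Type*} [AddCommGroup L] [Module 𝔄 L] [AddCommGroup M] [Module 𝔄 M]
  [AddCommGroup N] [Module 𝔄 N] (φ : S →ₐ[𝔄] K)

/-- The specialization of an `S`-linear map between scalar extensions along `φ : S → K`. -/
def specialize (g : (S ⊗[𝔄] M) →ₗ[S] (S ⊗[𝔄] N)) : (K ⊗[𝔄] M) →ₗ[K] (K ⊗[𝔄] N) :=
  LinearMap.liftBaseChange K
    (φ.toLinearMap.rTensor N ∘ₗ g.restrictScalars 𝔄 ∘ₗ TensorProduct.mk 𝔄 S M 1)

theorem rTensor_smul (s : S) (y : S ⊗[𝔄] M) :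
    φ.toLinearMap.rTensor M (s • y) = φ s • φ.toLinearMap.rTensor M y := by
  induction y using TensorProduct.induction_on with
  | zero => simp
  | add x y hx hy => simp only [smul_add, map_add, hx, hy]
  | tmul a m => simp [TensorProduct.smul_tmul']

/-- This square determines `specialize φ g`, since the image of `φ ⊗ 1` contains the generators `1 ⊗
m`. Functoriality in `g` follows from it. -/
theorem specialize_rTensor (g : (S ⊗[𝔄] M) →ₗ[S] (S ⊗[𝔄] N)) (x : S ⊗[𝔄] M) :
    specialize φ g (φ.toLinearMap.rTensor M x) = φ.toLinearMap.rTensor N (g x) := by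
  induction x using TensorProduct.induction_on with
  | zero => simp
  | add x y hx hy => simp only [map_add, hx, hy]
  | tmul s m =>
    have : s ⊗ₜ[𝔄] m = s • ((1 : S) ⊗ₜ[𝔄] m) := by simp [TensorProduct.smul_tmul']
    rw [this, rTensor_smul, map_smul g, rTensor_smul, map_smul]
    simp [specialize]

theorem specialize_one_tmul (g : (S ⊗[𝔄] M) →ₗ[S] (S ⊗[𝔄] N)) (m : M) :
    specialize φ g (1 ⊗ₜ m) = φ.toLinearMap.rTensor N (g (1 ⊗ₜ m)) := by
  simp [specialize]

theorem specialize_comp (g : (S ⊗[𝔄] M) →ₗ[S] (S ⊗[𝔄] N)) (h : (S ⊗[𝔄] L) →ₗ[S] (S ⊗[𝔄] M)) :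
    specialize φ (g ∘ₗ h) = specialize φ g ∘ₗ specialize φ h := by
  ext m
  simp [specialize_one_tmul, specialize_rTensor]

theorem specialize_baseChange (f : M →ₗ[𝔄] N) :
    specialize φ (f.baseChange S) = f.baseChange K := by
  ext m
  simp [specialize_one_tmul]

theorem specialize_id : specialize φ (LinearMap.id : (S ⊗[𝔄] M) →ₗ[S] _) = LinearMap.id := by
  ext m
  simp [specialize_one_tmul]

/-- The specialization of an isomorphism of scalar extensions. -/
def specializeEquiv (e : (S ⊗[𝔄] M) ≃ₗ[S] (S ⊗[𝔄] N)) : (K ⊗[𝔄] M) ≃ₗ[K] (K ⊗[𝔄] N) :=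
  LinearEquiv.ofLinearMap (specialize φ e.toLinearMap) (specialize φ e.symm.toLinearMap)
    (by rw [← specialize_comp, LinearEquiv.comp_symm, specialize_id])
    (by rw [← specialize_comp, LinearEquiv.symm_comp, specialize_id])

theorem specializeEquiv_trans (e : (S ⊗[𝔄] L) ≃ₗ[S] (S ⊗[𝔄] M))
    (e' : (S ⊗[𝔄] M) ≃ₗ[S] (S ⊗[𝔄] N)) :
    specializeEquiv φ (e.trans e') = (specializeEquiv φ e).trans (specializeEquiv φ e') :=
  LinearEquiv.toLinearMap_injective (specialize_comp φ e'.toLinearMap e.toLinearMap)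

end Specialization

universe v s

variable {𝔄 : Type v} {S : Type s} [CommRing 𝔄] [CommRing S] [Algebra 𝔄 S]
  {K : Type*} [Field K] [Algebra 𝔄 K] (φ ψ : S →ₐ[𝔄] K)

theorem TwistedForm.Hom.specialize_comm {X Y : TwistedForm 𝔄 S} (α : X.Hom Y)
    (x : K ⊗[𝔄] X.L₁) : specializeEquiv φ Y.iso (α.f₁.baseChange K x) =
      α.f₂.baseChange K (specializeEquiv φ X.iso x) := by
  have h := congrArg (specialize φ) α.comm
  rw [specialize_comp, specialize_comp, specialize_baseChange, specialize_baseChange] at h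
  exact LinearMap.congr_fun h x

/-- The automorphism of `K ⊗ L₁` that compares the specializations of a twisted form along two
homomorphisms `S → K`. -/
def compareAut (X : TwistedForm 𝔄 S) : (K ⊗[𝔄] X.L₁) ≃ₗ[K] (K ⊗[𝔄] X.L₁) :=
  (specializeEquiv ψ X.iso).trans (specializeEquiv φ X.iso).symm

/-- Both specializations intertwine `f₁` with `f₂`; passing forth along `ψ` and back along `φ`
cancels `f₂`. -/
theorem compareAut_comm {X Y : TwistedForm 𝔄 S} (α : X.Hom Y) :
    (compareAut φ ψ Y).toLinearMap ∘ₗ α.f₁.baseChange K =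
      α.f₁.baseChange K ∘ₗ (compareAut φ ψ X).toLinearMap := by
  refine LinearMap.ext fun x => ?_
  change (specializeEquiv φ Y.iso).symm (specializeEquiv ψ Y.iso (α.f₁.baseChange K x)) =
    α.f₁.baseChange K ((specializeEquiv φ X.iso).symm (specializeEquiv ψ X.iso x))
  rw [LinearEquiv.symm_apply_eq, α.specialize_comm, α.specialize_comm, LinearEquiv.apply_symm_apply]

theorem det_compareAut_of_iso {X Y : TwistedForm 𝔄 S} (α : X.Hom Y)
    (h₁ : Function.Bijective α.f₁) :
    LinearEquiv.det (compareAut φ ψ X) = LinearEquiv.det (compareAut φ ψ Y) := by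
  let e : (K ⊗[𝔄] X.L₁) ≃ₗ[K] (K ⊗[𝔄] Y.L₁) :=
    (LinearEquiv.ofBijective α.f₁ h₁).baseChange 𝔄 K _ _
  rw [← LinearEquiv.det_conj (compareAut φ ψ X) e]
  congr 1
  ext y
  obtain ⟨x, rfl⟩ := e.surjective y
  simp only [LinearEquiv.trans_apply, LinearEquiv.symm_apply_apply]
  exact (LinearMap.congr_fun (compareAut_comm φ ψ α) x).symm

theorem det_compareAut_of_exact {X Y Z : TwistedForm 𝔄 S} (α : X.Hom Y) (β : Y.Hom Z)
    (inj : Function.Injective α.f₁) (ex : Function.Exact α.f₁ β.f₁)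
    (surj : Function.Surjective β.f₁) :
    LinearEquiv.det (compareAut φ ψ Y) =
      LinearEquiv.det (compareAut φ ψ X) * LinearEquiv.det (compareAut φ ψ Z) := by
  -- `Z.L₁` is projective, so the sequence splits; the retraction `l` keeps the left map injective
  -- after base change to `K`, although `K` need not be flat over `𝔄`.
  obtain ⟨r, hr⟩ := Module.projective_lifting_property β.f₁ LinearMap.id surj
  have hsplit : (Function.Injective α.f₁ ∧ ∃ l, β.f₁ ∘ₗ l = LinearMap.id) ↔
      (Function.Surjective β.f₁ ∧ ∃ l, l ∘ₗ α.f₁ = LinearMap.id) := ex.split_tfae'.out 0 1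
  obtain ⟨-, l, hl⟩ := hsplit.1 ⟨inj, r, hr⟩
  refine Units.ext ?_
  rw [Units.val_mul, LinearEquiv.coe_det, LinearEquiv.coe_det, LinearEquiv.coe_det]
  refine LinearMap.det_eq_mul_of_exact (α.f₁.baseChange K) (β.f₁.baseChange K) ?_ ?_ ?_ _ _ _
    (compareAut_comm φ ψ α) (compareAut_comm φ ψ β)
  · have h : l.baseChange K ∘ₗ α.f₁.baseChange K = LinearMap.id := by
      rw [← LinearMap.baseChange_comp, hl, LinearMap.baseChange_id]
    exact Function.LeftInverse.injective (LinearMap.congr_fun h)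
  · exact lTensor_exact K ex surj
  · exact LinearMap.lTensor_surjective K surj

theorem det_compareAut_comp (M₁ M₂ M₃ : Type v) [AddCommGroup M₁] [AddCommGroup M₂]
    [AddCommGroup M₃] [Module 𝔄 M₁] [Module 𝔄 M₂] [Module 𝔄 M₃]
    [Module.Finite 𝔄 M₁] [Module.Finite 𝔄 M₂] [Module.Finite 𝔄 M₃]
    [Module.Projective 𝔄 M₁] [Module.Projective 𝔄 M₂] [Module.Projective 𝔄 M₃]
    (η' : (S ⊗[𝔄] M₁) ≃ₗ[S] (S ⊗[𝔄] M₃)) (η : (S ⊗[𝔄] M₃) ≃ₗ[S] (S ⊗[𝔄] M₂)) :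
    LinearEquiv.det (compareAut φ ψ ⟨M₁, M₂, η'.trans η⟩) =
      LinearEquiv.det (compareAut φ ψ ⟨M₁, M₃, η'⟩) *
        LinearEquiv.det (compareAut φ ψ ⟨M₃, M₂, η⟩) := by
  -- Writing `C` for `compareAut`, `(η η')_φ⁻¹ (η η')_ψ = (η'_φ⁻¹ C(η) η'_φ) · C(η')`, and the first
  -- factor is a conjugate of `C(η)`.
  rw [← LinearEquiv.det_conj (compareAut φ ψ ⟨M₃, M₂, η⟩) (specializeEquiv φ η').symm, mul_comm,
    ← map_mul]
  congr 1
  refine LinearEquiv.ext fun x => ?_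
  simp [compareAut, specializeEquiv_trans, LinearEquiv.mul_apply]

/-- The homomorphism `K₀(𝔄, S) → Kˣ` that takes `[L₁, L₂; iso]` to the determinant of the automorphism
comparing the specializations of `iso` along `φ` and `ψ`. -/
def compareDet : K0 𝔄 S →+ Additive Kˣ :=
  QuotientAddGroup.lift _
    (FreeAbelianGroup.lift fun X => Additive.ofMul (LinearEquiv.det (compareAut φ ψ X))) (by
      rw [AddSubgroup.closure_le]
      intro x hx
      rw [SetLike.mem_coe, AddMonoidHom.mem_ker]
      cases hx with
      | iso X Y α h₁ h₂ =>
        rw [map_sub, FreeAbelianGroup.lift_apply_of, FreeAbelianGroup.lift_apply_of,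
          det_compareAut_of_iso φ ψ α h₁, sub_self]
      | exact X Y Z α β inj ex surj =>
        rw [map_sub, map_add, FreeAbelianGroup.lift_apply_of, FreeAbelianGroup.lift_apply_of,
          FreeAbelianGroup.lift_apply_of, det_compareAut_of_exact φ ψ α β inj ex surj, ofMul_mul,
          sub_self]
      | comp M₁ M₂ M₃ η' η =>
        rw [map_sub, map_add, FreeAbelianGroup.lift_apply_of, FreeAbelianGroup.lift_apply_of,
          FreeAbelianGroup.lift_apply_of, det_compareAut_comp, ofMul_mul, sub_self])

theorem compareDet_mk (X : TwistedForm 𝔄 S) :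
    compareDet φ ψ (K0.mk X) = Additive.ofMul (LinearEquiv.det (compareAut φ ψ X)) :=
  FreeAbelianGroup.lift_apply_of _ _

theorem specializeEquiv_unitForm (s : Sˣ) (x : K ⊗[𝔄] (unitForm 𝔄 s).L₁) :
    specializeEquiv φ (unitForm 𝔄 s).iso x = φ s • x := by
  suffices h : specialize φ (LinearEquiv.smulOfUnit s : (S ⊗[𝔄] 𝔄) ≃ₗ[S] _).toLinearMap =
      φ s • LinearMap.id from LinearMap.congr_fun h x
  refine TensorProduct.AlgebraTensorModule.ext fun k a => ?_
  have h : ∀ y : S ⊗[𝔄] 𝔄, (LinearEquiv.smulOfUnit s : (S ⊗[𝔄] 𝔄) ≃ₗ[S] _) y = (s : S) • y :=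
    fun _ => rfl
  have hk : k ⊗ₜ[𝔄] a = k • ((1 : K) ⊗ₜ[𝔄] a) := by simp [TensorProduct.smul_tmul']
  rw [hk, map_smul, map_smul, specialize_one_tmul, LinearEquiv.coe_coe, h, rTensor_smul]
  simp

/-- The comparison is a scalar on the line `K ⊗ 𝔄`, so its determinant is that scalar. -/
theorem det_compareAut_unitForm (s : Sˣ) :
    (LinearEquiv.det (compareAut φ ψ (unitForm 𝔄 s)) : K) = (φ s)⁻¹ * ψ s := by
  have hu : φ s ≠ 0 := (s.isUnit.map φ).ne_zero
  have h₁ : (compareAut φ ψ (unitForm 𝔄 s)).toLinearMap = ((φ s)⁻¹ * ψ s) • LinearMap.id := by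
    refine LinearMap.ext fun x => ?_
    change (specializeEquiv φ (unitForm 𝔄 s).iso).symm
      (specializeEquiv ψ (unitForm 𝔄 s).iso x) = ((φ s)⁻¹ * ψ s) • x
    rw [LinearEquiv.symm_apply_eq, specializeEquiv_unitForm, specializeEquiv_unitForm, smul_smul,
      mul_inv_cancel_left₀ hu]
  have h₂ : Module.finrank K (K ⊗[𝔄] (unitForm 𝔄 s).L₁) = 1 :=
    (TensorProduct.AlgebraTensorModule.rid 𝔄 K K).finrank_eq.trans (Module.finrank_self K)
  rw [LinearEquiv.coe_det, h₁, LinearMap.det_smul, LinearMap.det_id, mul_one, h₂, pow_one]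

theorem apply_eq_of_boundary_eq_zero (s : Sˣ)
    (h : boundary 𝔄 S (Additive.ofMul s) = 0) : φ s = ψ s := by
  have h₁ : LinearEquiv.det (compareAut φ ψ (unitForm 𝔄 s)) = 1 :=
    Additive.ofMul.injective ((compareDet_mk φ ψ _).symm.trans
      ((congrArg (compareDet φ ψ) h).trans (map_zero _)))
  have h₂ := det_compareAut_unitForm φ ψ s
  rw [h₁, Units.val_one] at h₂
  exact (inv_mul_eq_one₀ (s.isUnit.map φ).ne_zero).1 h₂.symm

variable (S) in
-- The pair `(t, id)` is an isomorphism of twisted forms from `(𝔄, 𝔄; t)` to `(𝔄, 𝔄; 1)`.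
theorem boundary_algebraMap_eq_zero (t : 𝔄ˣ) :
    boundary 𝔄 S (Additive.ofMul (Units.map (algebraMap 𝔄 S : 𝔄 →* S) t)) = 0 := by
  suffices h : boundary 𝔄 S (Additive.ofMul (Units.map (algebraMap 𝔄 S : 𝔄 →* S) t)) =
      boundary 𝔄 S (Additive.ofMul 1) from h.trans (map_zero (boundary 𝔄 S))
  rw [← sub_eq_zero]
  have h (y : S ⊗[𝔄] 𝔄) : ((t : 𝔄) • (LinearMap.id : 𝔄 →ₗ[𝔄] 𝔄)).baseChange S y =
      algebraMap 𝔄 S t • y := by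
    rw [LinearMap.baseChange_smul, LinearMap.baseChange_id, algebraMap_smul]
    rfl
  refine (QuotientAddGroup.eq_zero_iff _).2 (AddSubgroup.subset_closure
    (IsRelation.iso (unitForm 𝔄 (Units.map (algebraMap 𝔄 S : 𝔄 →* S) t)) (unitForm 𝔄 1)
      ⟨(t : 𝔄) • (LinearMap.id : 𝔄 →ₗ[𝔄] 𝔄), (LinearMap.id : 𝔄 →ₗ[𝔄] 𝔄), ?_⟩
      (LinearEquiv.smulOfUnit t : 𝔄 ≃ₗ[𝔄] 𝔄).bijective Function.bijective_id))
  refine LinearMap.ext fun (x : S ⊗[𝔄] 𝔄) => ?_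
  change (1 : S) • ((t : 𝔄) • (LinearMap.id : 𝔄 →ₗ[𝔄] 𝔄)).baseChange S x =
    (LinearMap.id : 𝔄 →ₗ[𝔄] 𝔄).baseChange S (algebraMap 𝔄 S t • x)
  rw [h, one_smul, LinearMap.baseChange_id]
  rfl

end RelK

/-! ### Torsion units and descent of points -/

/-- The sum `1 + u + ⋯ + u^(n-1)` is `n` plus a nilpotent element, hence a unit, and its product
with `u - 1` is `u^n - 1 = 0`. -/
theorem eq_one_of_pow_eq_one_of_isNilpotent_sub_one {S : Type*} [CommRing S] [Algebra ℚ S] {u : S}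
    {n : ℕ} (hn : n ≠ 0) (hu : u ^ n = 1) (h : IsNilpotent (u - 1)) : u = 1 := by
  obtain ⟨c, hc⟩ : u - 1 ∣ (∑ i ∈ Finset.range n, u ^ i) - n := by
    have : (∑ i ∈ Finset.range n, u ^ i) - n = ∑ i ∈ Finset.range n, (u ^ i - 1) := by simp
    rw [this]
    exact Finset.dvd_sum fun i _ => by simpa using sub_dvd_pow_sub_pow u 1 i
  have hunit : IsUnit (∑ i ∈ Finset.range n, u ^ i) := by
    rw [← add_sub_cancel (n : S) (∑ i ∈ Finset.range n, u ^ i), hc]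
    refine ((Commute.all (u - 1) c).isNilpotent_mul_right h).isUnit_add_left_of_commute
      ?_ (Commute.all _ _)
    have : IsUnit (n : ℚ) := (Nat.cast_ne_zero.2 hn).isUnit
    simpa using this.map (algebraMap ℚ S)
  have hg : (∑ i ∈ Finset.range n, u ^ i) * (u - 1) = 0 := by rw [geom_sum_mul, hu, sub_self]
  exact sub_eq_zero.1 ((hunit.mul_right_eq_zero).1 hg)

/-- A homomorphism from a finite algebra over an integrally closed domain `R` to a Galois extension
of the fraction field has values in `R` if it is fixed by the Galois group. -/
theorem exists_algHom_of_fixed {R B F E : Type*} [CommRing R] [IsDomain R] [IsIntegrallyClosed R]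
    [CommRing B] [Algebra R B] [Module.Finite R B] [Field F] [Algebra R F] [IsFractionRing R F]
    [Field E] [Algebra F E] [Algebra R E] [IsScalarTower R F E] [IsGalois F E]
    (γ : B →ₐ[R] E) (h : ∀ (ω : E ≃ₐ[F] E) (b : B), ω (γ b) = γ b) :
    ∃ δ : B →ₐ[R] R, (Algebra.ofId R E).comp δ = γ := by
  have hinj : Function.Injective (algebraMap R E) := by
    rw [IsScalarTower.algebraMap_eq R F E]
    exact (algebraMap F E).injective.comp (IsFractionRing.injective R F)
  have hb (b : B) : ∃ r : R, algebraMap R E r = γ b := by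
    obtain ⟨x, hx⟩ := (InfiniteGalois.mem_bot_iff_fixed (k := F) (γ b)).2 fun ω => h ω b
    change algebraMap F E x = γ b at hx
    have hint : IsIntegral R (algebraMap F E x) :=
      hx ▸ (Algebra.IsIntegral.isIntegral (R := R) b).map γ
    rw [isIntegral_algebraMap_iff (algebraMap F E).injective,
      IsIntegrallyClosed.isIntegral_iff] at hint
    obtain ⟨r, hr⟩ := hint
    exact ⟨r, by rw [IsScalarTower.algebraMap_apply R F E, hr, hx]⟩
  choose f hf using hb
  -- The algebra homomorphism laws for `f` hold because they hold for `γ` and `R → E` is injective.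
  refine ⟨⟨⟨⟨⟨f, ?_⟩, ?_⟩, ?_, ?_⟩, ?_⟩, AlgHom.ext hf⟩ <;> intros <;> apply hinj <;> simp [hf]

/-! ### Points of the group scheme and their classes -/

namespace GroupScheme

/-- Points extend to `K`-algebra maps `K ⊗ B → K`, and a finite-dimensional algebra has only
finitely many of these. -/
theorem finite_points (R B : Type*) [CommRing R] [CommRing B] [HopfAlgebra R B] (K : Type*) [Field K] [Algebra R K] [Module.Finite R B] :
    Finite (Points R B K) := by
  let f : Points R B K → (K ⊗[R] B →ₐ[K] K) := fun γ =>
    Algebra.TensorProduct.lift (AlgHom.id K K) γ.ofConv fun _ _ => Commute.all _ _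
  refine Finite.of_injective f fun γ δ h => WithConv.ext (AlgHom.ext fun b => ?_)
  simpa [f] using AlgHom.congr_fun h (1 ⊗ₜ b)

universe u w

variable (R : Type u) [CommRing R] (B : Type w) [CommRing B] [HopfAlgebra R B]
  [Coalgebra.IsCocomm R B]

section Functoriality

variable {E E' E'' : Type*} [CommRing E] [Algebra R E] [CommRing E'] [Algebra R E']
  [CommRing E''] [Algebra R E'']

theorem extMap_extMap (g : E' →ₐ[R] E'') (f : E →ₐ[R] E') (x : DualExt R B E) :
    extMap R B g (extMap R B f x) = extMap R B (g.comp f) x := by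
  induction x using TensorProduct.induction_on with
  | zero => simp
  | add x y hx hy => simp only [map_add, hx, hy]
  | tmul a c => simp [extMap]

theorem extToConv_extMap (f : E →ₐ[R] E') (x : DualExt R B E) (b : B) :
    (extToConv R B E' (extMap R B f x)).ofConv b = f ((extToConv R B E x).ofConv b) := by
  induction x using TensorProduct.induction_on with
  | zero => simp
  | add x y hx hy => simp [hx, hy]
  | tmul a c =>
    rw [extToConv_tmul, extMap, Algebra.TensorProduct.map_tmul, extToConv_tmul, map_smul]
    rfl

variable [IsNoetherianRing R] [Module.Finite R B] [Module.Flat R B]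

theorem pointsToUnits_injective : Function.Injective (pointsToUnits R B E) := fun γ δ h => by
  apply WithConv.ext
  ext b
  rw [← extToConv_pointsToUnits, h, extToConv_pointsToUnits]

/-- Identifies the action of `f` on the coefficients of `A_E` with composition of points with `f`.
-/
theorem extMap_pointsToUnits (f : E →ₐ[R] E') (γ : Points R B E) :
    extMap R B f (pointsToUnits R B E γ) =
      pointsToUnits R B E' (WithConv.toConv (f.comp γ.ofConv)) := by
  apply (extToConv_bijective R B E').1
  apply WithConv.ext
  ext b
  rw [extToConv_extMap, extToConv_pointsToUnits, extToConv_pointsToUnits]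
  rfl

end Functoriality

section Field

variable [IsNoetherianRing R] [Module.Finite R B] [Module.Flat R B]

/-- A point whose class in the relative `K`-group is trivial is fixed by every automorphism. -/
theorem fixed_of_boundary_eq_zero {E : Type*} [Field E] [CharZero E] [Algebra R E]
    (σ : E →ₐ[R] E) (γ : Points R B E)
    (h : RelK.boundary (Dual R B) (DualExt R B E) (Additive.ofMul (pointsToUnits R B E γ)) = 0)
    (b : B) : σ (γ.ofConv b) = γ.ofConv b := by
  let σγ : Points R B E := WithConv.toConv (σ.comp γ.ofConv)
  suffices hσ : σγ * γ⁻¹ = 1 by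
    have := mul_inv_eq_one.1 hσ
    exact AlgHom.congr_fun (congrArg WithConv.ofConv this) b
  apply pointsToUnits_injective R B
  rw [map_one, map_mul, map_inv]
  refine Units.ext ?_
  rw [Units.val_one]
  have := finite_points R B E
  let : Algebra ℚ E := DivisionRing.toRatAlgebra
  let : Algebra ℚ (DualExt R B E) :=
    ((Algebra.TensorProduct.includeRight : E →ₐ[R] DualExt R B E).toRingHom.comp
      (algebraMap ℚ E)).toAlgebra
  -- The exponent is the order of `σγ · γ⁻¹` in the finite group of points; nilpotency is tested
  -- prime by prime, so `A_E` need not be known to be reduced.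
  refine eq_one_of_pow_eq_one_of_isNilpotent_sub_one
    (orderOf_pos (σγ * γ⁻¹)).ne' ?_ (nilpotent_iff_mem_prime.2 fun p hp => ?_)
  · rw [← map_inv, ← map_mul, ← Units.val_pow_eq_pow_val, ← map_pow, pow_orderOf_eq_one, map_one,
      Units.val_one]
  -- `σ` acts only on the factor `E`, so `σS` is `𝔄`-linear and `φ`, `φ ∘ σS` are two admissible
  -- specializations.
  · let σS : DualExt R B E →ₐ[Dual R B] DualExt R B E :=
      Algebra.TensorProduct.map (AlgHom.id (Dual R B) (Dual R B)) σ
    let φ : DualExt R B E →ₐ[Dual R B] FractionRing (DualExt R B E ⧸ p) :=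
      (IsScalarTower.toAlgHom (Dual R B) (DualExt R B E ⧸ p) _).comp
        (Ideal.Quotient.mkₐ (Dual R B) p)
    have hφ : φ (pointsToUnits R B E γ) = φ (σS (pointsToUnits R B E γ)) :=
      RelK.apply_eq_of_boundary_eq_zero φ (φ.comp σS) _ h
    have hσS : σS (pointsToUnits R B E γ) = pointsToUnits R B E σγ :=
      extMap_pointsToUnits R B σ γ
    rw [hσS] at hφ
    have h₁ := Ideal.Quotient.eq.1 (IsFractionRing.injective (DualExt R B E ⧸ p)
      (FractionRing (DualExt R B E ⧸ p)) hφ.symm)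
    have h₂ := p.mul_mem_right (((pointsToUnits R B E γ)⁻¹ : (DualExt R B E)ˣ) : DualExt R B E) h₁
    rwa [sub_mul, Units.mul_inv] at h₂

end Field

section Classes

variable [IsNoetherianRing R] [Module.Finite R B] [Module.Flat R B]
  {E : Type*} [CommRing E] [Algebra R E]

/-- A point defined over `R` has trivial class in the relative `K`-group. -/
theorem boundary_point_eq_zero (δ : B →ₐ[R] R) :
    RelK.boundary (Dual R B) (DualExt R B E) (Additive.ofMul
      (pointsToUnits R B E (WithConv.toConv ((Algebra.ofId R E).comp δ)))) = 0 := by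
  let e : DualExt R B R ≃ₐ[Dual R B] Dual R B := Algebra.TensorProduct.rid R (Dual R B) (Dual R B)
  -- The `R`-point `δ`, seen as a unit of `𝔄 ⊗_R R = 𝔄`.
  let t : (Dual R B)ˣ := Units.map (e : DualExt R B R →* Dual R B)
    (pointsToUnits R B R (WithConv.toConv δ))
  have ht : Units.map (algebraMap (Dual R B) (DualExt R B E) : Dual R B →* DualExt R B E) t =
      pointsToUnits R B E (WithConv.toConv ((Algebra.ofId R E).comp δ)) := by
    refine Units.ext ((?_ : _ = _).trans
      (extMap_pointsToUnits R B (Algebra.ofId R E) (WithConv.toConv δ)))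
    change algebraMap (Dual R B) (DualExt R B E) (e (pointsToUnits R B R (WithConv.toConv δ))) = _
    generalize (pointsToUnits R B R (WithConv.toConv δ) : DualExt R B R) = x
    let g : DualExt R B R →ₐ[Dual R B] DualExt R B E :=
      Algebra.TensorProduct.map (AlgHom.id (Dual R B) (Dual R B)) (Algebra.ofId R E)
    change algebraMap (Dual R B) (DualExt R B E) (e x) = g x
    rw [← g.commutes]
    congr 1
    exact e.symm_apply_apply x
  rw [← ht]
  exact RelK.boundary_algebraMap_eq_zero _ t

theorem K0proj_bijective_iff : Function.Bijective (K0proj R B E) ↔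
    ∀ γ : Points R B E, RelK.boundary (Dual R B) (DualExt R B E)
      (Additive.ofMul (pointsToUnits R B E γ)) = 0 := by
  have hsurj : Function.Surjective (K0proj R B E) := QuotientAddGroup.mk'_surjective _
  have hker : (K0proj R B E).ker = pointClasses R B E := QuotientAddGroup.ker_mk' _
  rw [Function.Bijective, and_iff_left hsurj, ← AddMonoidHom.ker_eq_bot_iff, hker, eq_bot_iff]
  constructor
  · intro h γ
    exact AddSubgroup.mem_bot.1 (h ⟨Additive.ofMul γ, rfl⟩)
  · rintro h _ ⟨γ, rfl⟩
    exact h γ.toMul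

end Classes

/-! ### The idelic description -/

section Idelic

open IsDedekindDomain

variable [IsDedekindDomain R] (F : Type*) [Field F] [Algebra R F] [IsFractionRing R F]
  [Module.Finite R B] [Module.Flat R B]
  (E : Type*) [CommRing E] [Algebra R E] [Algebra F E] [IsScalarTower R F E]

theorem idelicProj_bijective_iff : Function.Bijective (idelicProj R B F E) ↔
    ∀ γ : Points R B E, ((1 : JfModUf R B F), pointsToUnits R B E γ) ∈ (DeltaOne R B F E).range := by
  have hU : Function.Surjective (toUnitsModGam R B E) := QuotientGroup.mk'_surjective _
  have hsurj : Function.Surjective (idelicProj R B F E) := by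
    intro y
    obtain ⟨⟨j, a⟩, rfl⟩ := QuotientGroup.mk_surjective y
    obtain ⟨a, rfl⟩ := hU a
    exact ⟨QuotientGroup.mk (j, a), rfl⟩
  rw [Function.Bijective, and_iff_left hsurj, injective_iff_map_eq_one]
  constructor
  · intro h γ
    refine (QuotientGroup.eq_one_iff _).1 (h _ ((QuotientGroup.eq_one_iff _).2 ?_))
    have : modGam R B F E (1, pointsToUnits R B E γ) = 1 :=
      Prod.ext rfl ((QuotientGroup.eq_one_iff _).2 ⟨_, rfl⟩)
    rw [this]
    exact one_mem _
  · intro h x hx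
    obtain ⟨⟨j, a⟩, rfl⟩ := QuotientGroup.mk_surjective x
    obtain ⟨b, hb⟩ := (QuotientGroup.eq_one_iff (modGam R B F E (j, a))).1 hx
    have h₁ : (DeltaOne R B F E b).1 = j := congrArg Prod.fst hb
    have h₂ : toUnitsModGam R B E (DeltaOne R B F E b).2 = toUnitsModGam R B E a :=
      congrArg Prod.snd hb
    obtain ⟨γ, hγ⟩ := QuotientGroup.eq.1 h₂
    refine (QuotientGroup.eq_one_iff _).2 ?_
    -- A kernel element agrees with some `Δ'(b)` up to a point of `Γ` in the second factor.
    have : (j, a) = DeltaOne R B F E b * (1, pointsToUnits R B E γ) := by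
      refine Prod.ext ?_ ?_
      · simp [h₁]
      · change a = _ * pointsToUnits R B E γ
        rw [hγ, mul_inv_cancel_left]
    rw [this]
    exact mul_mem ⟨b, rfl⟩ (h γ)

/-- A point whose class in the idelic description is trivial is fixed by every automorphism. -/
theorem fixed_of_mem_range_DeltaOne (σ : E →ₐ[F] E) (γ : Points R B E)
    (h : ((1 : JfModUf R B F), pointsToUnits R B E γ) ∈ (DeltaOne R B F E).range) (b : B) :
    σ (γ.ofConv b) = γ.ofConv b := by
  obtain ⟨a, ha⟩ := h
  have h₁ : extMap R B (IsScalarTower.toAlgHom R F E) ((a⁻¹ : (DualExt R B F)ˣ) : DualExt R B F) =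
      pointsToUnits R B E γ := congrArg (fun x => Units.val (Prod.snd x)) ha
  rw [← extToConv_pointsToUnits, ← h₁, extToConv_extMap]
  -- The values of `γ` are images of the values of an element of `Hom_R(B, F)`.
  exact σ.commutes _

/-- A point defined over `R` has trivial class in the idelic description. -/
theorem mem_range_DeltaOne (δ : B →ₐ[R] R) :
    ((1 : JfModUf R B F), pointsToUnits R B E (WithConv.toConv ((Algebra.ofId R E).comp δ))) ∈
      (DeltaOne R B F E).range := by
  let a : (DualExt R B R)ˣ := pointsToUnits R B R (WithConv.toConv δ)
  let aF : (DualExt R B F)ˣ :=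
    Units.map (extMap R B (Algebra.ofId R F) : DualExt R B R →* DualExt R B F) a
  have hmem (v : HeightOneSpectrum R) (x : DualExt R B R) :
      toAloc R B F v (extMap R B (Algebra.ofId R F) x) ∈ orderLoc R B F v := by
    refine ⟨extMap R B (Algebra.ofId R (v.adicCompletionIntegers F)) x, ?_⟩
    change extMap R B _ _ = extMap R B _ _
    rw [extMap_extMap, extMap_extMap]
    congr 2
  have hdiag (c : (DualExt R B R)ˣ) : toJfModUf R B F (diag R B F
      (Units.map (extMap R B (Algebra.ofId R F) : DualExt R B R →* DualExt R B F) c)) = 1 :=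
    (QuotientGroup.eq_one_iff _).2 fun v => ⟨hmem v c, hmem v (c⁻¹ : (DualExt R B R)ˣ)⟩
  -- The inverse compensates for the one in the second component of `Δ'`; the idele component is
  -- trivial by `hdiag`.
  refine ⟨aF⁻¹, Prod.ext ?_ ?_⟩
  · change toJfModUf R B F (diag R B F aF⁻¹) = 1
    rw [map_inv, map_inv, hdiag, inv_one]
  · change (Units.map (extMap R B (IsScalarTower.toAlgHom R F E) :
      DualExt R B F →* DualExt R B E) aF⁻¹)⁻¹ = _
    rw [map_inv, inv_inv]
    refine Units.ext ((?_ : _ = _).trans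
      (extMap_pointsToUnits R B (Algebra.ofId R E) (WithConv.toConv δ)))
    change extMap R B _ (extMap R B _ _) = _
    rw [extMap_extMap]
    congr 2
    exact Subsingleton.elim _ _

end Idelic
end GroupScheme
end

theorem mainTheorem12 {R F Fc B : Type*} [CommRing R] [IsDedekindDomain R]
    [Field F] [NumberField F] [Algebra R F] [IsFractionRing R F]
    [Field Fc] [Algebra F Fc] [IsAlgClosure F Fc] [Algebra R Fc] [IsScalarTower R F Fc]
    [CommRing B] [HopfAlgebra R B] [Coalgebra.IsCocomm R B] [Module.Finite R B] [Module.Flat R B] :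
    (Function.Bijective (GroupScheme.K0proj R B Fc) ↔
      ∀ (ω : Fc ≃ₐ[F] Fc) (γ : B →ₐ[R] Fc) (b : B), ω (γ b) = γ b) ∧
    (Function.Bijective (GroupScheme.idelicProj R B F Fc) ↔
      ∀ (ω : Fc ≃ₐ[F] Fc) (γ : B →ₐ[R] Fc) (b : B), ω (γ b) = γ b) := by
  have : CharZero Fc := charZero_of_injective_algebraMap (algebraMap F Fc).injective
  have hpt (h : ∀ (ω : Fc ≃ₐ[F] Fc) (γ : B →ₐ[R] Fc) (b : B), ω (γ b) = γ b)
      (γ : GroupScheme.Points R B Fc) :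
      ∃ δ : B →ₐ[R] R, γ = WithConv.toConv ((Algebra.ofId R Fc).comp δ) := by
    -- `Fc` is Galois over `F`, which has characteristic zero, so invariant points descend to `R`.
    obtain ⟨δ, hδ⟩ := exists_algHom_of_fixed (F := F) γ.ofConv
      fun ω b => h ω γ.ofConv b
    exact ⟨δ, WithConv.ext hδ.symm⟩
  rw [GroupScheme.K0proj_bijective_iff, GroupScheme.idelicProj_bijective_iff]
  refine ⟨⟨fun h ω γ b => ?_, fun h γ => ?_⟩, ⟨fun h ω γ b => ?_, fun h γ => ?_⟩⟩
  · exact GroupScheme.fixed_of_boundary_eq_zero R B (ω.toAlgHom.restrictScalars R)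
      (WithConv.toConv γ) (h _) b
  · obtain ⟨δ, rfl⟩ := hpt h γ
    exact GroupScheme.boundary_point_eq_zero R B δ
  · exact GroupScheme.fixed_of_mem_range_DeltaOne R B F Fc ω.toAlgHom (WithConv.toConv γ) (h _) b
  · obtain ⟨δ, rfl⟩ := hpt h γ
    exact GroupScheme.mem_range_DeltaOne R B F Fc δ
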